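/- For a group $G$, the $Z^\pm$-power graph $\mathcal G^\pm(G)$ is the simple graph with vertex set $G$ in which distinct $x,y$ are adjacent if there is $n\in\mathbb Z\setminus\{0\}$ with $y=x^n$ or $x=y^n$. The directed $Z^\pm$-power graph $\vec{\mathcal G}^\pm(G)$ is the digraph with vertex set $G$ in which there is an edge from $x$ to $y\neq x$ if $y=x^n$ for some $n\in\mathbb Z\setminus\{0\}$, and the directed power graph $\vec{\mathcal G}(G)$ is the digraph with vertex set $G$ in which there is an edge from $x$ to $y\ne x$ if $y=x^n$ for some $n\in\mathbb Z$. Theorem. Let $G$ be a torsion-free group of nilpotency class $2$, and let $H$ be any group such that $\mathcal G^\pm(G)\cong\mathcal G^\pm(H)$. Then $\vec{\mathcal G}^\pm(G)\cong\vec{\mathcal G}^\pm(H)$, and also $\vec{\mathcal G}(G)\cong\vec{\mathcal G}(H)$. -/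

import Mathlib

/-- The `Z^±`-power graph of a group: distinct `x`, `y` are adjacent when one of them is a power
of the other with a non-zero integer exponent. -/
def zpmPowerGraph (G : Type*) [Group G] : SimpleGraph G where
  Adj x y := x ≠ y ∧ ∃ n : ℤ, n ≠ 0 ∧ (y = x ^ n ∨ x = y ^ n)
  symm := ⟨fun _ _ h => ⟨h.1.symm, h.2.imp fun _ hn => ⟨hn.1, hn.2.symm⟩⟩⟩
  loopless := ⟨fun _ h => h.1 rfl⟩

/-- The directed `Z^±`-power graph of a group: there is an edge from `x` to `y ≠ x` when `y` is a
power of `x` with a non-zero integer exponent. -/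
def directedZpmPowerGraph (G : Type*) [Group G] : Digraph G where
  Adj x y := x ≠ y ∧ ∃ n : ℤ, n ≠ 0 ∧ y = x ^ n

/-- The directed power graph of a group: there is an edge from `x` to `y ≠ x` when `y` is a power
of `x` with an arbitrary integer exponent. -/
def directedPowerGraph (G : Type*) [Group G] : Digraph G where
  Adj x y := x ≠ y ∧ ∃ n : ℤ, y = x ^ n

/-- Two digraphs are isomorphic when some bijection between their vertex sets preserves and
reflects directed edges. -/
def DigraphIsomorphic {V W : Type*} (Γ : Digraph V) (Δ : Digraph W) : Prop :=
  Nonempty (Γ.Adj ≃r Δ.Adj)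

/-!
A torsion-free group of class `2` has unique roots, so its commensurability classes, each taken
together with `1`, are locally cyclic groups, and they are the connected components of the
`Z^±`-power graph (with `1` alone in its own). Let `φ` be an isomorphism onto the graph of `H`.
As `1` is the only isolated vertex of `G`, it is fixed and `H` is torsion-free; `H` need not have
unique roots. Closed neighbourhoods in `G` determine elements up to inversion, so `φ` respects
inverses.

If `b` and `c` are both adjacent to `a` but not to each other, transitivity of the power relation
in `H` forces the images of the edges `ab` and `ac` to have the same orientation (`forcing_out`,
`forcing_in`). Using powers with prime exponents, this shows that, at each `x ≠ 1`, `φ` either preserves the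
orientation of all edges from `x` to its powers (`Forward`) or reverses all of them (`Backward`).
Being backward is constant on commensurability classes (`Backward.of_commensurable`); the proper
powers that `φ x` has in `H` provide the proper roots of `x` needed for this.

The poset structure of the powers of `φ x` further shows that a backward class is divisible
(`Backward.exists_prime_root`). It is therefore a copy of the non-zero rationals, and
`x ↦ x⁻¹` on those reverses the power relation (`IsReciprocal.nzPow`). Precomposing `φ` with
this involution on the backward classes gives a bijection that respects directed edges, and it fixes
the identity, which accounts for the additional edges of the directed power graph.
-/

namespace ZpmPowerGraph

/-! ### Non-zero powers in torsion-free groups -/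

/-- `y` is a power of `x` with non-zero exponent. This is the reflexive closure of the adjacency
relation of the directed `Z^±`-power graph. -/
def NzPow {G : Type*} [Group G] (x y : G) : Prop := ∃ n : ℤ, n ≠ 0 ∧ y = x ^ n

/-- One of `x`, `y` is a power of the other with non-zero exponent. This is the reflexive closure
of the adjacency relation of the `Z^±`-power graph. -/
def Comparable {G : Type*} [Group G] (x y : G) : Prop := NzPow x y ∨ NzPow y x

/-- `x` and `y` have a common power with non-zero exponents. -/
def Commensurable {G : Type*} [Group G] (x y : G) : Prop :=
  ∃ m n : ℤ, m ≠ 0 ∧ n ≠ 0 ∧ x ^ m = y ^ n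

section Group

variable {G : Type*} [Group G]

lemma NzPow.refl (x : G) : NzPow x x := ⟨1, one_ne_zero, by simp⟩

lemma nzPow_zpow (x : G) {n : ℤ} (hn : n ≠ 0) : NzPow x (x ^ n) := ⟨n, hn, rfl⟩

lemma NzPow.trans {x y z : G} (h : NzPow x y) (h' : NzPow y z) : NzPow x z := by
  obtain ⟨m, hm, rfl⟩ := h
  obtain ⟨n, hn, rfl⟩ := h'
  exact ⟨m * n, mul_ne_zero hm hn, by rw [zpow_mul]⟩

lemma nzPow_inv (x : G) : NzPow x x⁻¹ := ⟨-1, by simp, by simp⟩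

lemma nzPow_inv' (x : G) : NzPow x⁻¹ x := ⟨-1, by simp, by simp⟩

lemma Comparable.symm {x y : G} (h : Comparable x y) : Comparable y x := Or.symm h

lemma NzPow.commensurable {x y : G} (h : NzPow x y) : Commensurable x y := by
  obtain ⟨n, hn, rfl⟩ := h
  exact ⟨n, 1, hn, one_ne_zero, by simp⟩

lemma Commensurable.refl (x : G) : Commensurable x x := (NzPow.refl x).commensurable

lemma Commensurable.symm {x y : G} (h : Commensurable x y) : Commensurable y x := by
  obtain ⟨m, n, hm, hn, h⟩ := h
  exact ⟨n, m, hn, hm, h.symm⟩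

lemma Commensurable.trans {x y z : G} (h : Commensurable x y) (h' : Commensurable y z) :
    Commensurable x z := by
  obtain ⟨m, n, hm, hn, h⟩ := h
  obtain ⟨k, l, hk, hl, h'⟩ := h'
  refine ⟨m * k, l * n, mul_ne_zero hm hk, mul_ne_zero hl hn, ?_⟩
  rw [zpow_mul, h, zpow_mul, ← h', ← zpow_mul, ← zpow_mul, mul_comm]

lemma Comparable.commensurable {x y : G} (h : Comparable x y) : Commensurable x y :=
  h.elim NzPow.commensurable fun h => h.commensurable.symm

lemma nzPow_one_left {y : G} : NzPow 1 y ↔ y = 1 := by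
  constructor
  · rintro ⟨n, -, rfl⟩
    simp
  · rintro rfl
    exact NzPow.refl 1

variable (htf : ∀ x : G, x ≠ 1 → ¬ IsOfFinOrder x)
include htf

lemma zpow_inj_exponent {x : G} (hx : x ≠ 1) {m n : ℤ} : x ^ m = x ^ n ↔ m = n :=
  (injective_zpow_iff_not_isOfFinOrder.2 (htf x hx)).eq_iff

lemma zpow_ne_one {x : G} (hx : x ≠ 1) {n : ℤ} (hn : n ≠ 0) : x ^ n ≠ 1 := by
  rw [← zpow_zero x, Ne, zpow_inj_exponent htf hx]
  exact hn

lemma NzPow.ne_one {x y : G} (h : NzPow x y) (hx : x ≠ 1) : y ≠ 1 := by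
  obtain ⟨n, hn, rfl⟩ := h
  exact zpow_ne_one htf hx hn

lemma nzPow_one_right {x : G} (h : NzPow x 1) : x = 1 := by
  by_contra hx
  exact h.ne_one htf hx rfl

lemma Commensurable.ne_one {x y : G} (h : Commensurable x y) (hx : x ≠ 1) : y ≠ 1 := by
  rintro rfl
  obtain ⟨m, n, hm, -, h⟩ := h
  exact zpow_ne_one htf hx hm (by simpa using h)

lemma nzPow_zpow_zpow {x : G} (hx : x ≠ 1) {m n : ℤ} (hn : n ≠ 0) :
    NzPow (x ^ m) (x ^ n) ↔ m ∣ n := by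
  constructor
  · rintro ⟨k, -, h⟩
    rw [← zpow_mul, zpow_inj_exponent htf hx] at h
    exact ⟨k, h⟩
  · rintro ⟨k, rfl⟩
    exact ⟨k, right_ne_zero_of_mul hn, by rw [zpow_mul]⟩

lemma NzPow.antisymm {x y : G} (h : NzPow x y) (h' : NzPow y x) : y = x ∨ y = x⁻¹ := by
  by_cases hx : x = 1
  · subst hx
    exact Or.inl (nzPow_one_left.1 h)
  obtain ⟨n, hn, rfl⟩ := h
  have h1 : n ∣ 1 := (nzPow_zpow_zpow htf hx one_ne_zero).1 (by simpa using h')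
  rcases Int.isUnit_iff.1 (isUnit_of_dvd_one h1) with rfl | rfl <;> simp

lemma zpow_eq_self_or_inv {x : G} (hx : x ≠ 1) {n : ℤ} (h : x ^ n = x ∨ x ^ n = x⁻¹) :
    IsUnit n := by
  rw [Int.isUnit_iff]
  refine h.imp (fun h => ?_) (fun h => ?_)
  · exact (zpow_inj_exponent htf hx).1 (by simpa using h)
  · exact (zpow_inj_exponent htf hx).1 (by simpa using h)

end Group

/-- An integer that is neither zero nor a unit is incomparable, for divisibility, with every
sufficiently large prime. -/
lemma exists_prime_incomparable {m n : ℤ} (hm : m ≠ 0) (hm' : ¬ IsUnit m) (hn : n ≠ 0)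
    (hn' : ¬ IsUnit n) :
    ∃ q : ℤ, q ≠ 0 ∧ ¬ IsUnit q ∧ (¬ q ∣ m ∧ ¬ m ∣ q) ∧ ¬ q ∣ n ∧ ¬ n ∣ q := by
  obtain ⟨q, hq, hp⟩ := Nat.exists_infinite_primes (m.natAbs + n.natAbs + 1)
  have key : ∀ k : ℤ, k ≠ 0 → ¬ IsUnit k → k.natAbs < q → ¬ (q : ℤ) ∣ k ∧ ¬ k ∣ (q : ℤ) := by
    intro k hk hk' hlt
    constructor
    · intro h
      have := Nat.le_of_dvd (Int.natAbs_pos.2 hk) (Int.natCast_dvd.1 h)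
      omega
    · intro h
      rcases (Nat.dvd_prime hp).1 (Int.dvd_natCast.1 h) with h | h
      · exact hk' (Int.isUnit_iff_natAbs_eq.2 h)
      · omega
  refine ⟨q, by exact_mod_cast hp.ne_zero, ?_, key m hm hm' (by omega), key n hn hn' (by omega)⟩
  rw [Int.isUnit_iff_natAbs_eq, Int.natAbs_natCast]
  exact hp.ne_one

/-! ### Groups with unique roots -/

open scoped commutatorElement

/-- If `x ^ n = y ^ n`, the central commutator of `x` and `y` has trivial `n`-th power, so `x` and
`y` commute and `x * y⁻¹` is torsion. -/
lemma isMulTorsionFree_of_commutator_central {G : Type*} [Group G]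
    (htf : ∀ x : G, x ≠ 1 → ¬ IsOfFinOrder x)
    (hc : ∀ x y z : G, Commute ⁅x, y⁆ z) : IsMulTorsionFree G := by
  have tf : ∀ (x : G) (n : ℕ), n ≠ 0 → x ^ n = 1 → x = 1 := by
    intro x n hn h
    by_contra hx
    exact htf x hx (isOfFinOrder_iff_pow_eq_one.2 ⟨n, Nat.pos_of_ne_zero hn, h⟩)
  refine ⟨fun n hn x y (hxy : x ^ n = y ^ n) => ?_⟩
  have h1 : (⁅y, x⁆ * x) ^ n = x ^ n := by
    have : ⁅y, x⁆ * x = y * x * y⁻¹ := by simp [commutatorElement_def]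
    rw [this, conj_pow, hxy]
    group
  rw [(hc y x x).mul_pow] at h1
  have h2 : ⁅y, x⁆ = 1 := tf _ n hn (by simpa using h1)
  have h3 : Commute x y⁻¹ := (commutatorElement_eq_one_iff_commute.1 h2).symm.inv_right
  exact mul_inv_eq_one.1 (tf _ n hn (by rw [h3.mul_pow, hxy]; simp))

lemma commute_commutator_of_nilpotencyClass_eq_two {G : Type*} [Group G]
    (hnil : Group.IsNilpotent G) (hclass : Group.nilpotencyClass G = 2) (x y z : G) :
    Commute ⁅x, y⁆ z := by
  have h := Subgroup.lowerCentralSeries_nilpotencyClass (G := G)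
  rw [hclass, Subgroup.lowerCentralSeries_succ, Subgroup.lowerCentralSeries_succ,
    Subgroup.lowerCentralSeries_zero] at h
  have hmem := Subgroup.commutator_mem_commutator
    (Subgroup.commutator_mem_commutator (Subgroup.mem_top x) (Subgroup.mem_top y))
    (Subgroup.mem_top z)
  rw [h, Subgroup.mem_bot] at hmem
  exact commutatorElement_eq_one_iff_commute.1 hmem

section UniqueRoots

variable {G : Type*} [Group G] [IsMulTorsionFree G]

lemma not_isOfFinOrder_of_uniqueRoots (x : G) (hx : x ≠ 1) : ¬ IsOfFinOrder x := by
  rw [isOfFinOrder_iff_zpow_eq_one]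
  rintro ⟨n, hn, h⟩
  exact hx ((zpow_left_inj hn).1 (by simpa using h))

lemma Commensurable.exists_common_root {x y : G} (h : Commensurable x y) :
    ∃ (d : G) (i j : ℤ), x = d ^ i ∧ y = d ^ j := by
  obtain ⟨m, n, hm, hn, h⟩ := h
  have hcomm : Commute x y := by
    have h1 : (y * x * y⁻¹) ^ m = x ^ m := by
      rw [conj_zpow, h]
      group
    exact (mul_inv_eq_iff_eq_mul.1 ((zpow_left_inj hm).1 h1)).symm
  -- After extracting the `gcd` of the exponents, they are coprime and Bézout applies.
  obtain ⟨m', hm'⟩ := Int.gcd_dvd_left m n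
  obtain ⟨n', hn'⟩ := Int.gcd_dvd_right m n
  have hg : (Int.gcd m n : ℤ) ≠ 0 := by
    intro h0
    rw [h0, zero_mul] at hm'
    exact hm hm'
  have hxy : x ^ m' = y ^ n' := by
    refine (zpow_left_inj hg).1 ?_
    rw [← zpow_mul, ← zpow_mul, mul_comm m', mul_comm n', ← hm', ← hn', h]
  have hb : m' * m.gcdA n + n' * m.gcdB n = 1 := by
    apply mul_left_cancel₀ hg
    rw [mul_one, mul_add, ← mul_assoc, ← mul_assoc, ← hm', ← hn', ← Int.gcd_eq_gcd_ab]
  set u := m.gcdA n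
  set v := m.gcdB n
  have hc : Commute (x ^ v) (y ^ u) := (hcomm.zpow_left v).zpow_right u
  refine ⟨x ^ v * y ^ u, n', m', ?_, ?_⟩
  · rw [hc.mul_zpow, ← zpow_mul y, mul_comm u, zpow_mul y, ← hxy, ← zpow_mul, ← zpow_mul,
      ← zpow_add, show v * n' + m' * u = 1 by linarith, zpow_one]
  · rw [hc.mul_zpow, ← zpow_mul x, mul_comm v, zpow_mul x, hxy, ← zpow_mul, ← zpow_mul,
      ← zpow_add, show n' * v + u * m' = 1 by linarith, zpow_one]

lemma not_comparable_zpow {x : G} (hx : x ≠ 1) {m n : ℤ} (hm : m ≠ 0) (hn : n ≠ 0)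
    (hmn : ¬ m ∣ n) (hnm : ¬ n ∣ m) : ¬ Comparable (x ^ m) (x ^ n) := by
  have htf := not_isOfFinOrder_of_uniqueRoots (G := G)
  rintro (h | h)
  · exact hmn ((nzPow_zpow_zpow htf hx hn).1 h)
  · exact hnm ((nzPow_zpow_zpow htf hx hm).1 h)

/-- Two elements with the same closed neighbourhood in the `Z^±`-power graph are equal or inverse:
if `y = x ^ n` with `n` not a unit, then `x ^ q` for a large prime `q` is comparable with `x` but not
with `y`. -/
lemma eq_or_eq_inv_of_comparable_iff {x y : G} (hx : x ≠ 1)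
    (h : ∀ z, Comparable x z ↔ Comparable y z) : y = x ∨ y = x⁻¹ := by
  have htf := not_isOfFinOrder_of_uniqueRoots (G := G)
  have key : ∀ x y : G, x ≠ 1 → (∀ z, Comparable x z ↔ Comparable y z) → NzPow x y →
      y = x ∨ y = x⁻¹ := by
    rintro x _ hx h ⟨n, hn, rfl⟩
    by_cases hu : IsUnit n
    · rcases Int.isUnit_iff.1 hu with rfl | rfl <;> simp
    obtain ⟨q, hq, -, ⟨h1, h2⟩, -⟩ := exists_prime_incomparable hn hu hn hu
    rcases (h (x ^ q)).1 (Or.inl (nzPow_zpow x hq)) with h' | h'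
    · exact absurd ((nzPow_zpow_zpow htf hx hq).1 h') h2
    · exact absurd ((nzPow_zpow_zpow htf hx hn).1 h') h1
  rcases (h x).1 (Or.inl (NzPow.refl x)) with h' | h'
  · have hy : y ≠ 1 := by
      rintro rfl
      exact hx (nzPow_one_left.1 h')
    rcases key y x hy (fun z => (h z).symm) h' with h | h
    · exact Or.inl h.symm
    · exact Or.inr (by rw [h, inv_inv])
  · exact key x y hx h h'

end UniqueRoots

/-! ### Orientation of a graph isomorphism -/

section Orientation

variable {G H : Type*} [Group G] [Group H] (φ : G ≃ H)

/-- The bijection `φ` is an isomorphism of `Z^±`-power graphs, in terms of the reflexive closure of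
adjacency. -/
def PreservesComparable : Prop := ∀ x y, Comparable (φ x) (φ y) ↔ Comparable x y

/-- `φ` sends the powers of `x` to powers of `φ x`. -/
def Forward (x : G) : Prop := ∀ n : ℤ, n ≠ 0 → NzPow (φ x) (φ (x ^ n))

/-- `φ` sends the powers of `x` to elements of which `φ x` is a power. -/
def Backward (x : G) : Prop := ∀ n : ℤ, n ≠ 0 → NzPow (φ (x ^ n)) (φ x)

variable {φ}
variable (hφ : PreservesComparable φ)
include hφ

/-- Two edges at `a` whose other ends are not adjacent have images with the same orientation. -/
lemma forcing_out {a b c : G} (hac : Comparable a c) (hbc : ¬ Comparable b c)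
    (h : NzPow (φ a) (φ b)) : NzPow (φ a) (φ c) := by
  rcases (hφ a c).2 hac with h' | h'
  · exact h'
  · exact absurd ((hφ b c).1 (Or.inr (h'.trans h))) hbc

lemma forcing_in {a b c : G} (hac : Comparable a c) (hbc : ¬ Comparable b c)
    (h : NzPow (φ b) (φ a)) : NzPow (φ c) (φ a) := by
  rcases (hφ a c).2 hac with h' | h'
  · exact absurd ((hφ b c).1 (Or.inl (h.trans h'))) hbc
  · exact h'

variable [IsMulTorsionFree G]

/-- The identity of a torsion-free group is the only isolated vertex, and in any group an isolated
vertex is an involution adjacent to the identity unless it is the identity. -/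
lemma map_one_of_preservesComparable : φ 1 = 1 := by
  have hiso : ∀ h : H, Comparable (φ 1) h → h = φ 1 := by
    intro h hh
    rw [← φ.apply_symm_apply h, hφ] at hh
    rw [← φ.symm_apply_eq]
    exact hh.elim nzPow_one_left.1 (nzPow_one_right not_isOfFinOrder_of_uniqueRoots)
  have hinv : (φ 1)⁻¹ = φ 1 := hiso _ (Or.inl (nzPow_inv _))
  refine (hiso 1 (Or.inl ⟨2, two_ne_zero, ?_⟩)).symm
  rw [zpow_two]
  nth_rw 1 [← hinv]
  simp

lemma not_isOfFinOrder_of_preservesComparable (h : H) (hh : h ≠ 1) : ¬ IsOfFinOrder h := by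
  rw [isOfFinOrder_iff_zpow_eq_one]
  rintro ⟨n, hn, hn1⟩
  have h1 : Comparable (φ 1) (φ (φ.symm h)) := by
    rw [map_one_of_preservesComparable hφ, φ.apply_symm_apply]
    exact Or.inr ⟨n, hn, hn1.symm⟩
  rw [hφ] at h1
  have h2 : φ.symm h = 1 :=
    h1.elim nzPow_one_left.1 (nzPow_one_right not_isOfFinOrder_of_uniqueRoots)
  rw [φ.symm_apply_eq, map_one_of_preservesComparable hφ] at h2
  exact hh h2

lemma map_ne_one {x : G} (hx : x ≠ 1) : φ x ≠ 1 := by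
  rw [← map_one_of_preservesComparable hφ]
  exact fun h => hx (φ.injective h)

/-- `φ x` and its inverse have the same closed neighbourhood, hence so have their preimages. -/
lemma map_inv_of_preservesComparable (x : G) : φ x⁻¹ = (φ x)⁻¹ := by
  by_cases hx : x = 1
  · subst hx
    simp [map_one_of_preservesComparable hφ]
  have htf := not_isOfFinOrder_of_preservesComparable hφ
  have htw : ∀ z, Comparable x z ↔ Comparable (φ.symm (φ x)⁻¹) z := by
    intro z
    rw [← hφ, ← hφ (φ.symm _), φ.apply_symm_apply]
    constructor
    · exact fun h => h.imp (nzPow_inv' _).trans fun h => h.trans (nzPow_inv _)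
    · exact fun h => h.imp (nzPow_inv _).trans fun h => h.trans (nzPow_inv' _)
  rcases eq_or_eq_inv_of_comparable_iff hx htw with h | h
  · rw [φ.symm_apply_eq] at h
    -- `φ x` would be an involution.
    have h2 : (φ x) ^ (2 : ℤ) = 1 := by
      rw [zpow_two]
      nth_rw 1 [← h]
      simp
    exact absurd h2 (zpow_ne_one htf (map_ne_one hφ hx) two_ne_zero)
  · rw [φ.symm_apply_eq] at h
    exact h.symm

lemma NzPow.map_antisymm {x y : G} (h : NzPow (φ x) (φ y)) (h' : NzPow (φ y) (φ x)) :
    y = x ∨ y = x⁻¹ := by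
  refine (h.antisymm (not_isOfFinOrder_of_preservesComparable hφ) h').imp (fun h => φ.injective h)
    fun h => ?_
  rw [← map_inv_of_preservesComparable hφ] at h
  exact φ.injective h

/-- One correctly oriented edge from `x` to a proper power orients all of them: for a large
prime `q`, `x ^ q` is not adjacent to either of the two powers of `x` to be compared. -/
lemma forward_of_nzPow {x : G} (hx : x ≠ 1) {n : ℤ} (hn : n ≠ 0) (hn' : ¬ IsUnit n)
    (h : NzPow (φ x) (φ (x ^ n))) : Forward φ x := by
  intro m hm
  by_cases hm' : IsUnit m
  · rcases Int.isUnit_iff.1 hm' with rfl | rfl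
    · simpa using NzPow.refl (φ x)
    · simpa [map_inv_of_preservesComparable hφ] using nzPow_inv (φ x)
  obtain ⟨q, hq, -, ⟨h1, h2⟩, h3, h4⟩ := exists_prime_incomparable hm hm' hn hn'
  exact forcing_out hφ (Or.inl (nzPow_zpow x hm)) (not_comparable_zpow hx hq hm h1 h2)
    (forcing_out hφ (Or.inl (nzPow_zpow x hq)) (not_comparable_zpow hx hn hq h4 h3) h)

lemma backward_of_nzPow {x : G} (hx : x ≠ 1) {n : ℤ} (hn : n ≠ 0) (hn' : ¬ IsUnit n)
    (h : NzPow (φ (x ^ n)) (φ x)) : Backward φ x := by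
  intro m hm
  by_cases hm' : IsUnit m
  · rcases Int.isUnit_iff.1 hm' with rfl | rfl
    · simpa using NzPow.refl (φ x)
    · simpa [map_inv_of_preservesComparable hφ] using nzPow_inv' (φ x)
  obtain ⟨q, hq, -, ⟨h1, h2⟩, h3, h4⟩ := exists_prime_incomparable hm hm' hn hn'
  exact forcing_in hφ (Or.inl (nzPow_zpow x hm)) (not_comparable_zpow hx hq hm h1 h2)
    (forcing_in hφ (Or.inl (nzPow_zpow x hq)) (not_comparable_zpow hx hn hq h4 h3) h)

lemma forward_or_backward {x : G} (hx : x ≠ 1) : Forward φ x ∨ Backward φ x := by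
  have h2 : ¬ IsUnit (2 : ℤ) := by decide
  exact ((hφ _ _).2 (Or.inl (nzPow_zpow x two_ne_zero))).imp
    (forward_of_nzPow hφ hx two_ne_zero h2) (backward_of_nzPow hφ hx two_ne_zero h2)

/-! ### Backward commensurability classes -/

lemma Backward.zpow_of_incomparable {x : G} (hx : x ≠ 1) {m n : ℤ} (hm : m ≠ 0) (hn : n ≠ 0)
    (hmn : ¬ m ∣ n) (hnm : ¬ n ∣ m) (h : Backward φ (x ^ m)) : Backward φ (x ^ n) := by
  have htf := not_isOfFinOrder_of_uniqueRoots (G := G)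
  have hm' : ¬ IsUnit m := fun hu => hmn hu.dvd
  refine backward_of_nzPow hφ (zpow_ne_one htf hx hn) hm hm' ?_
  have h1 := h n hn
  rw [← zpow_mul] at h1 ⊢
  rw [mul_comm] at h1
  refine forcing_out hφ (Or.inr ?_) (not_comparable_zpow hx hm hn hmn hnm) h1
  exact (nzPow_zpow_zpow htf hx (mul_ne_zero hn hm)).2 (dvd_mul_right n m)

lemma Backward.zpow_of_zpow {x : G} (hx : x ≠ 1) {m n : ℤ} (hm : m ≠ 0) (hm' : ¬ IsUnit m)
    (hn : n ≠ 0) (hn' : ¬ IsUnit n) (h : Backward φ (x ^ m)) : Backward φ (x ^ n) := by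
  obtain ⟨q, hq, -, ⟨h1, h2⟩, h3, h4⟩ := exists_prime_incomparable hm hm' hn hn'
  exact (h.zpow_of_incomparable hφ hx hm hq h2 h1).zpow_of_incomparable hφ hx hq hn h3 h4

/-- Proper powers of `φ x` come from proper roots of a backward element `x`, and these are again
backward. -/
lemma Backward.exists_root {x : G} (hx : x ≠ 1) (h : Backward φ x) {k : ℤ} (hk : k ≠ 0)
    (hk' : ¬ IsUnit k) :
    ∃ (y : G) (r : ℤ), x = y ^ r ∧ r ≠ 0 ∧ ¬ IsUnit r ∧ φ y = φ x ^ k ∧ y ≠ 1 ∧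
      Backward φ y := by
  have htf := not_isOfFinOrder_of_preservesComparable hφ
  obtain ⟨y, hy⟩ := φ.surjective (φ x ^ k)
  have hne : ¬ (φ y = φ x ∨ φ y = (φ x)⁻¹) := by
    rw [hy]
    exact fun h' => hk' (zpow_eq_self_or_inv htf (map_ne_one hφ hx) h')
  have hxy : NzPow (φ x) (φ y) := ⟨k, hk, hy⟩
  have hyx : NzPow y x := by
    rcases (hφ x y).1 (Or.inl hxy) with ⟨j, hj, rfl⟩ | h'
    · exact absurd (hxy.antisymm htf (h j hj)) hne
    · exact h'
  obtain ⟨r, hr, rfl⟩ := hyx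
  have hy1 : y ≠ 1 := by
    rintro rfl
    simp at hx
  have hr' : ¬ IsUnit r := by
    intro hu
    apply hne
    rcases Int.isUnit_iff.1 hu with rfl | rfl
    · simp
    · simp [map_inv_of_preservesComparable hφ]
  exact ⟨y, r, rfl, hr, hr', hy, hy1, backward_of_nzPow hφ hy1 hr hr' hxy⟩

lemma Backward.zpow {x : G} (hx : x ≠ 1) (h : Backward φ x) {k : ℤ} (hk : k ≠ 0) :
    Backward φ (x ^ k) := by
  obtain ⟨y, r, rfl, hr, hr', -, hy, -⟩ :=
    h.exists_root hφ hx two_ne_zero (by decide : ¬ IsUnit (2 : ℤ))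
  rw [← zpow_mul]
  exact h.zpow_of_zpow hφ hy hr hr' (mul_ne_zero hr hk) fun hu => hr' (isUnit_of_mul_isUnit_left hu)

/-- If `z ^ 2` is backward, the preimages of the square and of the cube of `φ (z ^ 2)` are roots of
`z ^ 2` that differ by more than inversion, so one of them yields a proper root of `z`, and `z` is a
proper power inside a cyclic group that contains backward proper powers. -/
lemma Backward.of_zpow {z : G} (hz : z ≠ 1) {n : ℤ} (hn : n ≠ 0) (h : Backward φ (z ^ n)) :
    Backward φ z := by
  have htfG := not_isOfFinOrder_of_uniqueRoots (G := G)
  have htf := not_isOfFinOrder_of_preservesComparable hφ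
  have h2 : ¬ IsUnit (2 : ℤ) := by decide
  have h3 : ¬ IsUnit (3 : ℤ) := by decide
  by_cases hn' : IsUnit n
  · rcases Int.isUnit_iff.1 hn' with rfl | rfl
    · simpa using h
    · simpa using h.zpow hφ (zpow_ne_one htfG hz hn) hn
  have hb : Backward φ (z ^ (2 : ℤ)) := h.zpow_of_zpow hφ hz hn hn' two_ne_zero h2
  have hz2 : z ^ (2 : ℤ) ≠ 1 := zpow_ne_one htfG hz two_ne_zero
  have key : ∀ (y : G) (r : ℤ), z ^ (2 : ℤ) = y ^ r → ¬ IsUnit r → r ≠ 0 →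
      Backward φ z ∨ y = z ∨ y = z⁻¹ := by
    intro y r hyr hr' hr
    obtain ⟨d, i, j, rfl, rfl⟩ := Commensurable.exists_common_root ⟨2, r, two_ne_zero, hr, hyr⟩
    have hd : d ≠ 1 := by
      rintro rfl
      simp at hz
    have hi : i ≠ 0 := by
      rintro rfl
      simp at hz
    by_cases hi' : IsUnit i
    · right
      rw [← zpow_mul, ← zpow_mul, zpow_inj_exponent htfG hd] at hyr
      have hjr : j * r ∣ 2 := by
        rw [← hyr]
        exact (hi'.mul_left_dvd).2 dvd_rfl
      have hj : IsUnit j := by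
        obtain ⟨c, hc⟩ := hjr
        have hjr2 : j * (r * c) = 2 := by rw [hc]; ring
        rcases Int.prime_two.irreducible.isUnit_or_isUnit hjr2.symm with hu | hu
        · exact hu
        · exact absurd (isUnit_of_mul_isUnit_left hu) hr'
      rcases Int.isUnit_iff.1 hi' with rfl | rfl <;> rcases Int.isUnit_iff.1 hj with rfl | rfl <;>
        simp
    · left
      rw [← zpow_mul] at hb
      exact hb.zpow_of_zpow hφ hd (mul_ne_zero hi two_ne_zero)
        (fun hu => hi' (isUnit_of_mul_isUnit_left hu)) hi hi'
  obtain ⟨y, r, hyr, hr, hr', hy, -⟩ := hb.exists_root hφ hz2 two_ne_zero h2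
  obtain ⟨w, s, hws, hs, hs', hw, -⟩ := hb.exists_root hφ hz2 three_ne_zero h3
  rcases key y r hyr hr' hr with h' | hyz
  · exact h'
  rcases key w s hws hs' hs with h' | hwz
  · exact h'
  exfalso
  have hne := map_ne_one hφ hz2
  have hyw : φ y = φ w ∨ φ y = (φ w)⁻¹ := by
    rw [← map_inv_of_preservesComparable hφ, φ.injective.eq_iff, φ.injective.eq_iff]
    rcases hyz with rfl | rfl <;> rcases hwz with rfl | rfl <;> simp
  rw [hy, hw, ← zpow_neg, zpow_inj_exponent htf hne, zpow_inj_exponent htf hne] at hyw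
  omega

lemma Backward.of_commensurable {x y : G} (hx : x ≠ 1) (h : Backward φ x)
    (hxy : Commensurable x y) : Backward φ y := by
  have hy : y ≠ 1 := hxy.ne_one not_isOfFinOrder_of_uniqueRoots hx
  obtain ⟨m, n, hm, hn, hmn⟩ := hxy
  exact Backward.of_zpow hφ hy hn (hmn ▸ h.zpow hφ hx hm)

/-- A backward element `a` has a `p`-th root. In `G` nothing lies strictly between `a` and `a ^ p`,
so `φ a` is a `q`-th power of `φ (a ^ p)` up to inversion, for a prime `q`. The preimage `y` of the
`q`-th power of `φ a` is then such that only `a` lies strictly between `y` and `a ^ p`; as `y ^ p`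
does, it equals `a` up to inversion. -/
lemma Backward.exists_prime_root {a : G} (ha : a ≠ 1) (h : Backward φ a) {p : ℤ} (hp : Prime p) :
    ∃ y, y ^ p = a := by
  have htfG := not_isOfFinOrder_of_uniqueRoots (G := G)
  have htf := not_isOfFinOrder_of_preservesComparable hφ
  have hp0 := hp.ne_zero
  have hx : a ^ p ≠ 1 := zpow_ne_one htfG ha hp0
  have hx' := map_ne_one hφ hx
  have hbx : Backward φ (a ^ p) := h.zpow hφ ha hp0
  obtain ⟨q, hq0, hq⟩ := h p hp0
  have hqp : Prime q := by
    rw [← irreducible_iff_prime]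
    constructor
    · intro hu
      refine hp.not_isUnit (zpow_eq_self_or_inv htfG ha ?_)
      refine NzPow.map_antisymm hφ ?_ (h p hp0)
      rcases Int.isUnit_iff.1 hu with rfl | rfl
      · simpa [hq] using NzPow.refl (φ (a ^ p))
      · simpa [hq] using nzPow_inv' (φ (a ^ p))
    · -- A proper factorization of `q` would put an element strictly between `a` and `a ^ p`.
      intro u v huv
      by_contra! hcon
      have hu0 : u ≠ 0 := by
        rintro rfl
        simp at huv
        exact hq0 huv
      obtain ⟨z, t, hzt, ht0, ht, hz, hz1, hbz⟩ := hbx.exists_root hφ hx hu0 hcon.1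
      have hza : φ a = φ z ^ v := by rw [hq, hz, huv, zpow_mul]
      have hv0 : v ≠ 0 := by
        rintro rfl
        simp at huv
        exact hq0 huv
      obtain ⟨a', s, has, hs0, hs, ha', -⟩ := hbz.exists_root hφ hz1 hv0 hcon.2
      obtain rfl : a' = a := φ.injective (ha'.trans hza.symm)
      rw [has, ← zpow_mul, zpow_inj_exponent htfG ha] at hzt
      rcases hp.irreducible.isUnit_or_isUnit hzt with hu | hu
      · exact hs hu
      · exact ht hu
  obtain ⟨y, r, hyr, hr0, hr, hy, hy1, hby⟩ := h.exists_root hφ ha hq0 hqp.not_isUnit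
  have hw : NzPow (φ (a ^ p)) (φ (y ^ p)) := by
    have : a ^ p = (y ^ p) ^ r := by rw [hyr, ← zpow_mul, ← zpow_mul, mul_comm]
    rw [this]
    exact (hby.zpow hφ hy1 hp0) r hr0
  obtain ⟨s, hs0, hs⟩ := hw
  have hsq : s ∣ q ^ 2 := by
    have h1 := hby p hp0
    rw [hs, hy, hq, ← zpow_mul, nzPow_zpow_zpow htf hx' (mul_ne_zero hq0 hq0)] at h1
    rwa [sq]
  have hassoc : ∀ {z : G} {t : ℤ}, φ z = φ (a ^ p) ^ t → Associated s t →
      NzPow z (y ^ p) ∧ NzPow (y ^ p) z := by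
    intro z t hz hst
    have h1 : NzPow (φ z) (φ (y ^ p)) := by
      rw [hz, hs]
      exact (nzPow_zpow_zpow htf hx' hs0).2 hst.symm.dvd
    have h2 : NzPow (φ (y ^ p)) (φ z) := by
      have ht0 : t ≠ 0 := hst.ne_zero_iff.1 hs0
      rw [hz, hs]
      exact (nzPow_zpow_zpow htf hx' ht0).2 hst.dvd
    rcases NzPow.map_antisymm hφ h1 h2 with h3 | h3 <;> rw [h3]
    · exact ⟨NzPow.refl z, NzPow.refl z⟩
    · exact ⟨nzPow_inv z, nzPow_inv' z⟩
  -- Up to inversion, `y ^ p` is one of `a ^ p`, `a` and `y`.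
  obtain ⟨i, hi, hsi⟩ := (dvd_prime_pow hqp 2).1 hsq
  have hpr : r ∣ p := by
    interval_cases i
    · have h1 : NzPow (a ^ p) (y ^ p) := (hassoc (t := 1) (by simp) (by simpa using hsi)).1
      rw [hyr, ← zpow_mul, nzPow_zpow_zpow htfG hy1 hp0] at h1
      exact (dvd_mul_right r p).trans h1
    · have h1 : NzPow a (y ^ p) := (hassoc hq (by simpa using hsi)).1
      rwa [hyr, nzPow_zpow_zpow htfG hy1 hp0] at h1
    · have h1 : NzPow (y ^ p) (y ^ (1 : ℤ)) := by
        rw [zpow_one]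
        exact (hassoc (by rw [hy, hq, ← zpow_mul, sq]) hsi).2
      rw [nzPow_zpow_zpow htfG hy1 one_ne_zero] at h1
      exact absurd (isUnit_of_dvd_one h1) hp.not_isUnit
  obtain ⟨c, hc⟩ := hpr
  have hcu : IsUnit c := (hp.irreducible.isUnit_or_isUnit hc).resolve_left hr
  rcases Int.isUnit_iff.1 hcu with rfl | rfl
  · exact ⟨y, by rw [hyr, hc, mul_one]⟩
  · exact ⟨y⁻¹, by rw [hyr, hc, inv_zpow', mul_neg_one, neg_neg]⟩

lemma Backward.exists_root_of_ne_zero {a : G} (ha : a ≠ 1) (h : Backward φ a) {n : ℤ}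
    (hn : n ≠ 0) : ∃ y, y ^ n = a := by
  have key : ∀ n : ℕ, n ≠ 0 → ∀ a : G, a ≠ 1 → Backward φ a → ∃ y, y ^ n = a := by
    intro n
    induction n using induction_on_primes with
    | zero => exact fun h => absurd rfl h
    | one => exact fun _ a _ _ => ⟨a, pow_one a⟩
    | prime_mul p n hp ih =>
      intro hn a ha h
      obtain ⟨y, hy⟩ := h.exists_prime_root hφ ha (Nat.prime_iff_prime_int.1 hp)
      have hay : Commensurable a y :=
        (NzPow.commensurable ⟨p, by exact_mod_cast hp.ne_zero, hy.symm⟩).symm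
      obtain ⟨z, hz⟩ := ih (right_ne_zero_of_mul hn) y
        (hay.ne_one not_isOfFinOrder_of_uniqueRoots ha) (h.of_commensurable hφ ha hay)
      exact ⟨z, by rw [mul_comm, pow_mul, hz, ← hy, zpow_natCast]⟩
  obtain ⟨y, hy⟩ := key n.natAbs (Int.natAbs_ne_zero.2 hn) a ha h
  rcases Int.natAbs_eq n with h' | h'
  · exact ⟨y, by rw [h', zpow_natCast, hy]⟩
  · exact ⟨y⁻¹, by rw [h', inv_zpow', neg_neg, zpow_natCast, hy]⟩

end Orientation

/-! ### Reversing a divisible commensurability class -/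

section Reciprocal

variable {G : Type*} [Group G]

/-- `y` is the reciprocal of `x` relative to the base point `a`: when the commensurability class of
`a`, together with `1`, is identified with a subgroup of `ℚ` so that `a` becomes `1`, the numbers
`x = n / m` and `y = m / n` are reciprocal. -/
def IsReciprocal (a x y : G) : Prop :=
  ∃ m n : ℤ, m ≠ 0 ∧ n ≠ 0 ∧ x ^ m = a ^ n ∧ y ^ n = a ^ m

lemma IsReciprocal.symm {a x y : G} (h : IsReciprocal a x y) : IsReciprocal a y x := by
  obtain ⟨m, n, hm, hn, h1, h2⟩ := h
  exact ⟨n, m, hn, hm, h2, h1⟩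

lemma IsReciprocal.commensurable {a x y : G} (h : IsReciprocal a x y) : Commensurable x y := by
  obtain ⟨m, n, hm, hn, h1, h2⟩ := h
  exact Commensurable.trans ⟨m, n, hm, hn, h1⟩ (Commensurable.symm ⟨n, m, hn, hm, h2⟩)

variable [IsMulTorsionFree G]

lemma IsReciprocal.unique {a x y y' : G} (ha : a ≠ 1) (h : IsReciprocal a x y)
    (h' : IsReciprocal a x y') : y = y' := by
  have htf := not_isOfFinOrder_of_uniqueRoots (G := G)
  obtain ⟨m, n, hm, hn, h1, h2⟩ := h
  obtain ⟨k, l, hk, hl, h3, h4⟩ := h'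
  have h5 : n * k = l * m := by
    rw [← zpow_inj_exponent htf ha, zpow_mul, zpow_mul, ← h1, ← h3, ← zpow_mul, ← zpow_mul,
      mul_comm]
  refine (zpow_left_inj (mul_ne_zero hn hl)).1 ?_
  rw [zpow_mul, h2, mul_comm n, zpow_mul, h4, ← zpow_mul, ← zpow_mul, mul_comm k, h5, mul_comm]

/-- Taking reciprocals reverses the power relation. -/
lemma IsReciprocal.nzPow {a x y z w : G} (ha : a ≠ 1) (hxy : IsReciprocal a x y)
    (hzw : IsReciprocal a z w) (h : NzPow x z) : NzPow w y := by
  obtain ⟨k, hk, rfl⟩ := h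
  obtain ⟨m, n, hm, hn, h1, h2⟩ := hzw
  refine ⟨k, hk, hxy.unique ha ⟨k * m, n, mul_ne_zero hk hm, hn, ?_, ?_⟩⟩
  · rw [zpow_mul, h1]
  · rw [← zpow_mul, mul_comm, zpow_mul, h2, ← zpow_mul, mul_comm]

end Reciprocal

/-! ### The isomorphism of directed graphs -/

section Assembly

/-- Commensurability as a setoid. -/
def commensurableSetoid (G : Type*) [Group G] : Setoid G where
  r := Commensurable
  iseqv := ⟨Commensurable.refl, Commensurable.symm, Commensurable.trans⟩

/-- A chosen element of the commensurability class of `x`. -/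
noncomputable def basePoint {G : Type*} [Group G] (x : G) : G :=
  (Quotient.mk (commensurableSetoid G) x).out

lemma commensurable_basePoint {G : Type*} [Group G] (x : G) : Commensurable x (basePoint x) :=
  Commensurable.symm (Quotient.mk_out (s := commensurableSetoid G) x)

lemma Commensurable.basePoint_eq {G : Type*} [Group G] {x y : G} (h : Commensurable x y) :
    basePoint x = basePoint y :=
  congrArg Quotient.out (Quotient.sound (s := commensurableSetoid G) h)

variable {G H : Type*} [Group G] [Group H] {φ : G ≃ H} [IsMulTorsionFree G]
  (hφ : PreservesComparable φ)
include hφ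

lemma Backward.exists_isReciprocal {x : G} (hx : x ≠ 1) (h : Backward φ x) :
    ∃ y, IsReciprocal (basePoint x) x y := by
  have htf := not_isOfFinOrder_of_uniqueRoots (G := G)
  have hc := commensurable_basePoint x
  have ha := hc.ne_one htf hx
  obtain ⟨m, n, hm, hn, hmn⟩ := hc
  obtain ⟨y, hy⟩ := Backward.exists_root_of_ne_zero hφ (zpow_ne_one htf ha hm)
    ((h.of_commensurable hφ hx (commensurable_basePoint x)).zpow hφ ha hm) hn
  exact ⟨y, m, n, hm, hn, hmn, hy⟩

/-- Reciprocals on the backward classes and the identity elsewhere form an involution of `G`. -/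
lemma exists_involutive_reciprocal :
    ∃ ι : G → G, Function.Involutive ι ∧
      (∀ x, x ≠ 1 → Backward φ x → IsReciprocal (basePoint x) x (ι x)) ∧
      ∀ x, ¬ (x ≠ 1 ∧ Backward φ x) → ι x = x := by
  classical
  have htf := not_isOfFinOrder_of_uniqueRoots (G := G)
  have hex : ∀ x, ∃ y, (x ≠ 1 → Backward φ x → IsReciprocal (basePoint x) x y) ∧
      (¬ (x ≠ 1 ∧ Backward φ x) → y = x) := by
    intro x
    by_cases h : x ≠ 1 ∧ Backward φ x
    · obtain ⟨y, hy⟩ := h.2.exists_isReciprocal hφ h.1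
      exact ⟨y, fun _ _ => hy, fun h' => absurd h h'⟩
    · exact ⟨x, fun h1 h2 => absurd ⟨h1, h2⟩ h, fun _ => rfl⟩
  choose ι h1 h2 using hex
  refine ⟨ι, fun x => ?_, h1, h2⟩
  by_cases h : x ≠ 1 ∧ Backward φ x
  · have hr := h1 x h.1 h.2
    have hc := hr.commensurable
    have hr' := h1 (ι x) (hc.ne_one htf h.1) (h.2.of_commensurable hφ h.1 hc)
    rw [← hc.basePoint_eq] at hr'
    exact hr'.unique ((commensurable_basePoint x).ne_one htf h.1) hr.symm
  · rw [h2 x h, h2 x h]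

lemma nzPow_map_iff_of_not_backward {x y : G} (hx : ¬ (x ≠ 1 ∧ Backward φ x))
    (hy : ¬ (y ≠ 1 ∧ Backward φ y)) : NzPow (φ x) (φ y) ↔ NzPow x y := by
  have hfwd : ∀ x y, ¬ (x ≠ 1 ∧ Backward φ x) → NzPow x y → NzPow (φ x) (φ y) := by
    intro x y hx h
    by_cases hx1 : x = 1
    · subst hx1
      rw [nzPow_one_left.1 h]
      exact NzPow.refl _
    · obtain ⟨n, hn, rfl⟩ := h
      exact (forward_or_backward hφ hx1).resolve_right (fun h => hx ⟨hx1, h⟩) n hn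
  refine ⟨fun h => ?_, hfwd x y hx⟩
  rcases (hφ x y).1 (Or.inl h) with h' | h'
  · exact h'
  · rcases h.map_antisymm hφ (hfwd y x hy h') with rfl | rfl
    · exact NzPow.refl _
    · exact nzPow_inv _

lemma nzPow_map_iff_of_backward {x y : G} (hx : Backward φ x) (hy : Backward φ y) :
    NzPow (φ x) (φ y) ↔ NzPow y x := by
  have hbwd : ∀ x y, Backward φ y → NzPow y x → NzPow (φ x) (φ y) := by
    rintro _ y hy ⟨n, hn, rfl⟩
    exact hy n hn
  refine ⟨fun h => ?_, hbwd x y hy⟩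
  rcases (hφ x y).1 (Or.inl h) with h' | h'
  · rcases h.map_antisymm hφ (hbwd y x hx h') with rfl | rfl
    · exact NzPow.refl _
    · exact nzPow_inv' _
  · exact h'

/-- Precomposing `φ` with the involution that reverses the backward classes gives a bijection that
respects directed edges. -/
theorem exists_equiv_nzPow_iff :
    ∃ ψ : G ≃ H, ψ 1 = 1 ∧ ∀ x y, NzPow (ψ x) (ψ y) ↔ NzPow x y := by
  have htf := not_isOfFinOrder_of_uniqueRoots (G := G)
  obtain ⟨ι, hι, hrec, hid⟩ := exists_involutive_reciprocal hφ
  refine ⟨hι.toPerm.trans φ, ?_, fun x y => ?_⟩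
  · change φ (ι 1) = 1
    rw [hid 1 (fun h => h.1 rfl), map_one_of_preservesComparable hφ]
  change NzPow (φ (ι x)) (φ (ι y)) ↔ NzPow x y
  have hB : ∀ {x y : G}, Commensurable x y → (x ≠ 1 ∧ Backward φ x) → y ≠ 1 ∧ Backward φ y :=
    fun hc h => ⟨hc.ne_one htf h.1, h.2.of_commensurable hφ h.1 hc⟩
  have hιc : ∀ x, Commensurable x (ι x) := by
    intro x
    by_cases hx : x ≠ 1 ∧ Backward φ x
    · exact (hrec x hx.1 hx.2).commensurable
    · rw [hid x hx]
      exact Commensurable.refl x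
  by_cases hc : Commensurable x y
  · by_cases hx : x ≠ 1 ∧ Backward φ x
    · have hy := hB hc hx
      have ha := (commensurable_basePoint x).ne_one htf hx.1
      have hrx := hrec x hx.1 hx.2
      have hry := hrec y hy.1 hy.2
      rw [← hc.basePoint_eq] at hry
      rw [nzPow_map_iff_of_backward hφ (hB (hιc x) hx).2 (hB (hιc y) hy).2]
      exact ⟨hry.symm.nzPow ha hrx.symm, hrx.nzPow ha hry⟩
    · have hy : ¬ (y ≠ 1 ∧ Backward φ y) := fun hy => hx (hB hc.symm hy)
      rw [hid x hx, hid y hy, nzPow_map_iff_of_not_backward hφ hx hy]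
  · refine iff_of_false (fun h => hc ?_) (fun h => hc h.commensurable)
    have h' := ((hφ _ _).1 (Or.inl h)).commensurable
    exact ((hιc x).trans h').trans (hιc y).symm

end Assembly

lemma exists_eq_zpow_iff {G : Type*} [Group G] {x y : G} :
    (∃ n : ℤ, y = x ^ n) ↔ NzPow x y ∨ y = 1 := by
  constructor
  · rintro ⟨n, rfl⟩
    by_cases hn : n = 0
    · simp [hn]
    · exact Or.inl (nzPow_zpow x hn)
  · rintro (⟨n, -, h⟩ | rfl)
    · exact ⟨n, h⟩
    · exact ⟨0, by simp⟩

lemma comparable_iff_eq_or_adj {G : Type*} [Group G] {x y : G} :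
    Comparable x y ↔ x = y ∨ (zpmPowerGraph G).Adj x y := by
  by_cases hxy : x = y
  · subst hxy
    exact iff_of_true (Or.inl (NzPow.refl x)) (Or.inl rfl)
  · simp only [hxy, false_or, Comparable, NzPow, zpmPowerGraph, ne_eq, not_false_eq_true,
      true_and, ← exists_or, ← and_or_left]

lemma preservesComparable_of_iso {G H : Type*} [Group G] [Group H]
    (e : zpmPowerGraph G ≃g zpmPowerGraph H) : PreservesComparable e.toEquiv := by
  intro x y
  rw [comparable_iff_eq_or_adj, comparable_iff_eq_or_adj, e.toEquiv.injective.eq_iff]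
  exact or_congr_right e.map_adj_iff

end ZpmPowerGraph

open ZpmPowerGraph in
theorem mainTheorem4 {G : Type*} {H : Type*} [Group G] [Group H]
    (htf : ∀ x : G, x ≠ 1 → ¬ IsOfFinOrder x)
    (hnil : Group.IsNilpotent G) (hclass : Group.nilpotencyClass G = 2)
    (hiso : Nonempty (zpmPowerGraph G ≃g zpmPowerGraph H)) :
    DigraphIsomorphic (directedZpmPowerGraph G) (directedZpmPowerGraph H) ∧
      DigraphIsomorphic (directedPowerGraph G) (directedPowerGraph H) := by
  obtain ⟨e⟩ := hiso
  have : IsMulTorsionFree G := isMulTorsionFree_of_commutator_central htf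
    (commute_commutator_of_nilpotencyClass_eq_two hnil hclass)
  obtain ⟨ψ, h1, hψ⟩ := exists_equiv_nzPow_iff (preservesComparable_of_iso e)
  refine ⟨⟨ψ, fun {x y} => and_congr ψ.injective.ne_iff (hψ x y)⟩,
    ⟨ψ, fun {x y} => and_congr ψ.injective.ne_iff ?_⟩⟩
  rw [exists_eq_zpow_iff, exists_eq_zpow_iff, hψ, ← h1, ψ.injective.eq_iff]
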